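/- Assume the continuum hypothesis $2^{\aleph_0}=\aleph_1$. **Conventions.** An *ideal* on a countably infinite set $M$ is a family $\mathcal I\subseteq\mathcal P(M)$ that is closed under subsets and finite unions, contains all finite subsets of $M$, and does not contain $M$. A topological space $X$ is in $\mathrm{FinBW}(\mathcal I)$ if it is Hausdorff and for every sequence $(x_n)_{n\in M}$ in $X$ there are $A\notin\mathcal I$ and $x\in X$ such that $\{n\in A: x_n\notin U\}$ is finite for every open neighborhood $U$ of $x$. A topological space $X$ is *Hindman* if for every sequence $(x_n)_{n\in\omega}$ in $X$ there are $x\in X$ and an infinite $D\subseteq\omega$ such that for every open neighborhood $U$ of $x$ there is $m\in\omega$ with $x_n\in U$ for all $n\in FS(D\setminus\{0,\dots,m\})$, where $FS(E)$ is the set of all sums $\sum_{n\in F}n$ over finite nonempty $F\subseteq E$. Let $\mathrm{Fin}^2$ be the family of all $A\subseteq\omega^2$ such that $\{j:(n,j)\in A\}$ is finite for all but finitely many $n$, and let $\mathcal{BI}$ be the family of all $A\subseteq\omega^3$ for which there is $k\in\omega$ such that the section $A_{(i)}=\{(a,b)\in\omega^2:(i,a,b)\in A\}$ is in $\mathrm{Fin}^2$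 for each $i<k$ and is finite for each $i\ge k$. An ideal $\mathcal I$ on $M$ is *unboring* if there is no bijection $f:M\to\omega^3$ with $f^{-1}[A]\in\mathcal I$ for all $A\in\mathcal{BI}$. A *Mrówka space* is a space $\Phi(\mathcal A)$, where $\mathcal A$ is an infinite family of infinite subsets of $\omega$ any two distinct members of which have finite intersection; its underlying set is the disjoint union $\omega\cup\mathcal A\cup\{\infty\}$, points of $\omega$ are isolated, basic neighborhoods of $A\in\mathcal A$ are $\{A\}\cup(A\setminus F)$, and basic neighborhoods of $\infty$ are $\{\infty\}\cup(\mathcal A\setminus G)\cup\bigl(\omega\setminus(F\cup\bigcup_{A\in G}A)\bigr)$, with $F\subseteq\omega$ and $G\subseteq\mathcal A$ finite. **Theorem (CH).** Let $M$ be a countably infinite set. 1. There is no ideal $\mathcal I$ on $M$ such that the class $\mathrm{FinBW}(\mathcal I)$ coincides with the class of Hindman spaces; in fact, for no ideal $\mathcal I$ on $M$ is it true that every Hausdorff space $X$ satisfies: $X\in\mathrm{FinBW}(\mathcal I)$ if and only if $X$ is Hindman. 2. For every ideal $\mathcal I$ on $M$ the following are equivalent: (a) $\mathcal I$ is unboring;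 (b) there is an uncountable Mrówka space in $\mathrm{FinBW}(\mathcal I)$ that is not a Hindman space; (c) there is a space in $\mathrm{FinBW}(\mathcal I)$ that is not a Hindman space. -/

import Mathlib

/-- Ideals in the sense of infinite combinatorics: a proper (order) ideal of the power set of `M`
that contains all finite subsets of `M`. -/
structure IsIdealOn {M : Type*} (I : Order.Ideal (Set M)) : Prop where
  univ_notMem : Set.univ ∉ I
  mem_of_finite : ∀ A : Set M, A.Finite → A ∈ I

/-- The family `Fin²`: all but finitely many vertical sections are finite. -/
def FinSquared : Set (Set (ℕ × ℕ)) :=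
  {A | {n : ℕ | ¬ {j : ℕ | (n, j) ∈ A}.Finite}.Finite}

/-- The family `BI` of those `A ⊆ ω³` for which there is `k` such that the section `A_(i)` is in
`Fin²` for `i < k` and is finite for `i ≥ k`. -/
def BIdeal : Set (Set (ℕ × ℕ × ℕ)) :=
  {A | ∃ k : ℕ, (∀ i < k, {p : ℕ × ℕ | (i, p) ∈ A} ∈ FinSquared) ∧
    ∀ i, k ≤ i → {p : ℕ × ℕ | (i, p) ∈ A}.Finite}

/-- `𝒥` contains an isomorphic copy of `ℐ`: there is a bijection `f` from the underlying set of `𝒥`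
onto that of `ℐ` with `f⁻¹[A] ∈ 𝒥` for all `A ∈ ℐ`. -/
def ContainsCopy {X Y : Type*} (ℐ : Set (Set X)) (𝒥 : Set (Set Y)) : Prop :=
  ∃ f : Y → X, Function.Bijective f ∧ ∀ A ∈ ℐ, f ⁻¹' A ∈ 𝒥

/-- An ideal is boring if it contains an isomorphic copy of `BI`. -/
def IsBoring {M : Type*} (I : Order.Ideal (Set M)) : Prop :=
  ContainsCopy BIdeal (I : Set (Set M))

/-- An ideal is unboring if it is not boring. -/
def IsUnboring {M : Type*} (I : Order.Ideal (Set M)) : Prop :=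
  ¬ IsBoring I

/-- `X` is in `FinBW(I)`: `X` is Hausdorff, and each sequence in `X` indexed by `M` converges
along some set `A ∉ I` to some point of `X`. -/
def InFinBW {M : Type*} (I : Order.Ideal (Set M)) (X : Type*) [TopologicalSpace X] : Prop :=
  T2Space X ∧ ∀ x : M → X, ∃ A : Set M, A ∉ I ∧
    ∃ p : X, ∀ U : Set X, IsOpen U → p ∈ U → {n ∈ A | x n ∉ U}.Finite

/-- `FS(D)`: all sums of nonempty finite sets of (distinct) elements of `D`. -/
def finiteSums (D : Set ℕ) : Set ℕ :=
  {s | ∃ F : Finset ℕ, F.Nonempty ∧ (F : Set ℕ) ⊆ D ∧ ∑ n ∈ F, n = s}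

/-- Hindman spaces. -/
def IsHindman (X : Type*) [TopologicalSpace X] : Prop :=
  ∀ x : ℕ → X, ∃ p : X, ∃ D : Set ℕ, D.Infinite ∧
    ∀ U : Set X, IsOpen U → p ∈ U → ∃ m : ℕ, ∀ n ∈ finiteSums (D \ Set.Iic m), x n ∈ U

/-- Almost disjoint families of infinite subsets of `ω`. -/
def IsADFamily (𝒜 : Set (Set ℕ)) : Prop :=
  (∀ A ∈ 𝒜, A.Infinite) ∧ ∀ A ∈ 𝒜, ∀ B ∈ 𝒜, A ≠ B → (A ∩ B).Finite

/-- The underlying set `ω ∪ 𝒜 ∪ {∞}` (a disjoint union) of the space `Φ(𝒜)`. -/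
inductive MrowkaSpace (𝒜 : Set (Set ℕ)) : Type
  | nat (n : ℕ) : MrowkaSpace 𝒜
  | mem (A : 𝒜) : MrowkaSpace 𝒜
  | infty : MrowkaSpace 𝒜

namespace MrowkaSpace

/-- The basic neighbourhood `{A} ∪ (A \ F)` of the point `A ∈ 𝒜`. -/
def nhdMem {𝒜 : Set (Set ℕ)} (A : 𝒜) (F : Finset ℕ) : Set (MrowkaSpace 𝒜) :=
  {mem A} ∪ nat '' ((A : Set ℕ) \ F)

/-- The basic neighbourhood `{∞} ∪ (𝒜 \ G) ∪ (ω \ (F ∪ ⋃ G))` of the point `∞`. -/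
def nhdInfty {𝒜 : Set (Set ℕ)} (G : Finset 𝒜) (F : Finset ℕ) : Set (MrowkaSpace 𝒜) :=
  {infty} ∪ mem '' {A | A ∉ G} ∪ nat '' {n | n ∉ F ∧ ∀ A ∈ G, n ∉ (A : Set ℕ)}

/-- The topology of `Φ(𝒜)`: a set is open if it contains a basic neighbourhood of each of its
points; the points of `ω` are isolated. -/
instance instTopologicalSpace (𝒜 : Set (Set ℕ)) : TopologicalSpace (MrowkaSpace 𝒜) where
  IsOpen U := (∀ A : 𝒜, mem A ∈ U → ∃ F : Finset ℕ, nhdMem A F ⊆ U) ∧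
    (infty ∈ U → ∃ (G : Finset 𝒜) (F : Finset ℕ), nhdInfty G F ⊆ U)
  isOpen_univ := ⟨fun _ _ => ⟨∅, Set.subset_univ _⟩, fun _ => ⟨∅, ∅, Set.subset_univ _⟩⟩
  isOpen_inter U V hU hV := by
    classical
    refine ⟨fun A hA => ?_, fun h => ?_⟩
    · obtain ⟨F₁, h₁⟩ := hU.1 A hA.1
      obtain ⟨F₂, h₂⟩ := hV.1 A hA.2
      refine ⟨F₁ ∪ F₂, Set.subset_inter (subset_trans ?_ h₁) (subset_trans ?_ h₂)⟩ <;>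
      · rintro x (hx | ⟨n, hn, rfl⟩)
        · exact Or.inl hx
        · simp only [Finset.coe_union, Set.mem_sdiff, Set.mem_union, not_or] at hn
          exact Or.inr ⟨n, ⟨hn.1, by tauto⟩, rfl⟩
    · obtain ⟨G₁, F₁, h₁⟩ := hU.2 h.1
      obtain ⟨G₂, F₂, h₂⟩ := hV.2 h.2
      refine ⟨G₁ ∪ G₂, F₁ ∪ F₂, Set.subset_inter (subset_trans ?_ h₁) (subset_trans ?_ h₂)⟩ <;>
      · rintro x ((hx | ⟨A, hA, rfl⟩) | ⟨n, hn, rfl⟩)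
        · exact Or.inl (Or.inl hx)
        · simp only [Finset.mem_union, Set.mem_ofPred_eq, not_or] at hA
          exact Or.inl (Or.inr ⟨A, by simp [hA], rfl⟩)
        · simp only [Finset.mem_union, Set.mem_ofPred_eq, not_or] at hn
          exact Or.inr ⟨n, ⟨by tauto, fun A hA => hn.2 A (by tauto)⟩, rfl⟩
  isOpen_sUnion S hS := by
    refine ⟨?_, ?_⟩
    · rintro A ⟨U, hU, hA⟩
      obtain ⟨F, hF⟩ := (hS U hU).1 A hA
      exact ⟨F, hF.trans (Set.subset_sUnion_of_mem hU)⟩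
    · rintro ⟨U, hU, h⟩
      obtain ⟨G, F, hF⟩ := (hS U hU).2 h
      exact ⟨G, F, hF.trans (Set.subset_sUnion_of_mem hU)⟩

end MrowkaSpace

universe u v

open Filter Topology

/-! If `I` is boring, test a space in FinBW(I) on sequences indexed by `ω³`. Had it infinitely many
limits `p i` of one-to-one sequences `z i`, the sequence `(i, n, j) ↦ z i n` could converge only
along sets of `BIdeal` (`finite_setOf_isInjectiveLimit`). With finitely many such limits, an
idempotent ultrafilter selects one of them, or a constant value, and the diagonal form of Hindman's
theorem finishes (`IsHindman.of_finite_isInjectiveLimit`). The square of the unit interval is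
Hindman by compactness and first countability, but has too many limits for a boring ideal; this
refutes part 1 in the boring case.

If `I` is unboring, CH lists all coded sequences in type `ω₁`, and an almost disjoint family grows
along the list from the dyadic levels. At each stage the family is countable, and the current
sequence already has a positive convergent subsequence or yields a new set almost disjoint from the
family: failure of both would code a copy of BI inside `I` (`isSettled_or_exists_isNewLimit`). The
resulting Mrówka space is in FinBW(I). It is not Hindman, because the family is maximal and the
dyadic levels prevent a member from containing all finite sums of an infinite set
(`not_finiteSums_subset`). -/

/-! ### Hindman's theorem through idempotent ultrafilters -/

theorem exists_idempotent_ultrafilter_nat :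
    ∃ U : Ultrafilter ℕ, (∀ d, Set.Ioi d ∈ U) ∧
      ∀ S ∈ U, ∀ᶠ d in (U : Filter ℕ), {m | d + m ∈ S} ∈ U := by
  -- Working in `ℕ+` excludes the principal idempotent at `0`, so every idempotent is nonprincipal.
  -- The stream is arbitrary: only the existence of an idempotent is used.
  let _ := Ultrafilter.addSemigroup (M := ℕ+)
  obtain ⟨V, hV, -⟩ := Hindman.exists_idempotent_ultrafilter_le_FS (M := ℕ+) (Stream'.const 1)
  refine ⟨V.map PNat.val, fun d => ?_, fun S hS => ?_⟩
  · by_contra hd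
    have hfin : {m : ℕ+ | ¬ d < (m : ℕ)}.Finite := by
      refine Set.Finite.subset (Set.Finite.preimage PNat.coe_injective.injOn (Set.finite_Iic d)) ?_
      intro m hm
      simpa using hm
    have hmem : {m : ℕ+ | ¬ d < (m : ℕ)} ∈ V := by
      rw [Ultrafilter.mem_map] at hd
      exact Ultrafilter.compl_mem_iff_notMem.2 hd
    obtain ⟨a, -, rfl⟩ := Ultrafilter.eq_pure_of_finite_mem hfin hmem
    have h1 : ∀ᶠ m in ((pure a + pure a : Ultrafilter ℕ+) : Filter ℕ+), m = a + a := by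
      rw [Ultrafilter.eventually_add]
      simp [Ultrafilter.coe_pure]
    rw [hV] at h1
    have h2 : a = a + a := by simpa [Ultrafilter.coe_pure] using h1
    have h3 := congrArg PNat.val h2
    have h4 := a.pos
    simp only [PNat.add_coe] at h3
    omega
  · have h1 : ∀ᶠ m : ℕ+ in ((V + V : Ultrafilter ℕ+) : Filter ℕ+), (m : ℕ) ∈ S := by
      rw [hV]; exact hS
    rw [Ultrafilter.eventually_add] at h1
    rw [Ultrafilter.coe_map, eventually_map]
    filter_upwards [h1] with d hd
    rw [Ultrafilter.mem_map]
    exact hd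

/-- Hindman's theorem in diagonal form. -/
theorem exists_ultrafilter_finiteSums :
    ∃ U : Ultrafilter ℕ, ∀ A : ℕ → Set ℕ, (∀ k, A k ∈ U) →
      ∃ D : Set ℕ, D.Infinite ∧ ∀ k, ∃ m, finiteSums (D \ Set.Iic m) ⊆ A k := by
  obtain ⟨U, hU, hidem⟩ := exists_idempotent_ultrafilter_nat
  refine ⟨U, fun A hA => ?_⟩
  have hpick : ∀ S : {S : Set ℕ // S ∈ U}, ∃ d, d ∈ S.1 ∧ {m | d + m ∈ S.1} ∈ U := fun S =>
    ((show ∀ᶠ d in (U : Filter ℕ), d ∈ S.1 from S.2).and (hidem S.1 S.2)).exists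
  choose pick hp1 hp2 using hpick
  -- Every later choice `m` must lie in `A k`, exceed `pick S`, and keep `pick S + m` in `S`.
  let next : ℕ → {S : Set ℕ // S ∈ U} → {S : Set ℕ // S ∈ U} := fun k S =>
    ⟨S.1 ∩ A k ∩ {m | pick S + m ∈ S.1} ∩ Set.Ioi (pick S),
      inter_mem (inter_mem (inter_mem S.2 (hA k)) (hp2 S)) (hU _)⟩
  let S : ℕ → {S : Set ℕ // S ∈ U} := fun k =>
    Nat.rec ⟨Set.univ, univ_mem⟩ next k
  have hS : ∀ k, S (k + 1) = next k (S k) := fun k => rfl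
  let d : ℕ → ℕ := fun k => pick (S k)
  have hdS : ∀ k, d k ∈ (S k).1 := fun k => hp1 (S k)
  have hanti : Antitone fun k => (S k).1 := by
    refine antitone_nat_of_succ_le fun k x hx => ?_
    rw [hS] at hx
    exact hx.1.1.1
  have hmono : StrictMono d := by
    refine strictMono_nat_of_lt_succ fun k => ?_
    have := hdS (k + 1)
    rw [hS] at this
    exact this.2
  -- Peel off the least index `a`: the remaining sum lies in `S (a + 1)`, hence adding `d a` stays
  -- in `S a`.
  have hsum : ∀ G : Finset ℕ, ∀ k, G.Nonempty → (∀ i ∈ G, k ≤ i) → ∑ i ∈ G, d i ∈ (S k).1 := by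
    intro G
    induction G using Finset.induction_on_min with
    | empty => intro k h; simp at h
    | insert a s ha ih =>
      intro k _ hk
      have hka : k ≤ a := hk a (Finset.mem_insert_self _ _)
      have hnot : a ∉ s := fun h => lt_irrefl _ (ha a h)
      rw [Finset.sum_insert hnot]
      refine hanti hka ?_
      rcases s.eq_empty_or_nonempty with rfl | hs
      · simpa using hdS a
      · have := ih (a + 1) hs fun i hi => ha i hi
        rw [hS] at this
        exact this.1.2
  refine ⟨Set.range d, Set.infinite_range_of_injective hmono.injective, fun k => ⟨d k, ?_⟩⟩
  rintro _ ⟨F, hF, hFD, rfl⟩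
  have hF' : F = (F.preimage d hmono.injective.injOn).image d := by
    ext x
    simp only [Finset.mem_image, Finset.mem_preimage]
    constructor
    · intro hx
      obtain ⟨i, rfl⟩ := (hFD hx).1
      exact ⟨i, hx, rfl⟩
    · rintro ⟨i, hi, rfl⟩
      exact hi
  have hne : (F.preimage d hmono.injective.injOn).Nonempty := by
    rw [hF'] at hF
    exact Finset.image_nonempty.1 hF
  have := hsum (F.preimage d hmono.injective.injOn) (k + 1) hne (by
    intro i hi
    have := (hFD (Finset.mem_preimage.1 hi)).2
    simp only [Set.mem_Iic, not_le] at this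
    exact hmono.lt_iff_lt.1 this)
  rw [hF', Finset.sum_image hmono.injective.injOn]
  rw [hS] at this
  exact this.1.1.2

/-- Compactness makes the image of the Hindman ultrafilter converge; a countable base at the limit
feeds the diagonal form. -/
theorem IsHindman.of_compact_firstCountable (X : Type*) [TopologicalSpace X] [CompactSpace X]
    [FirstCountableTopology X] : IsHindman X := by
  intro x
  obtain ⟨U, hU⟩ := exists_ultrafilter_finiteSums
  obtain ⟨p, -, hp⟩ := isCompact_univ.ultrafilter_le_nhds (U.map x) (by simp)
  obtain ⟨V, hV⟩ := (𝓝 p).exists_antitone_basis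
  obtain ⟨D, hD, hDV⟩ := hU (fun k => x ⁻¹' V k) fun k => hp (hV.mem k)
  refine ⟨p, D, hD, fun W hW hpW => ?_⟩
  obtain ⟨k, hk⟩ := hV.mem_iff.1 (hW.mem_nhds hpW)
  obtain ⟨m, hm⟩ := hDV k
  exact ⟨m, fun n hn => hk (hm hn)⟩

theorem IsHindman.of_homeomorph {X Y : Type*} [TopologicalSpace X] [TopologicalSpace Y]
    (e : X ≃ₜ Y) (h : IsHindman X) : IsHindman Y := by
  intro x
  obtain ⟨p, D, hD, hp⟩ := h fun n => e.symm (x n)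
  refine ⟨e p, D, hD, fun U hU hpU => ?_⟩
  obtain ⟨m, hm⟩ := hp (e ⁻¹' U) (hU.preimage e.continuous) hpU
  exact ⟨m, fun n hn => by simpa using hm n hn⟩

theorem InFinBW.of_homeomorph {M X Y : Type*} [TopologicalSpace X] [TopologicalSpace Y]
    {I : Order.Ideal (Set M)} (e : X ≃ₜ Y) (h : InFinBW I X) : InFinBW I Y := by
  obtain ⟨hT, h⟩ := h
  refine ⟨e.symm.isEmbedding.t2Space, fun x => ?_⟩
  obtain ⟨A, hA, p, hp⟩ := h fun n => e.symm (x n)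
  refine ⟨A, hA, e p, fun U hU hpU => ?_⟩
  simpa using hp (e ⁻¹' U) (hU.preimage e.continuous) hpU

/-! ### Limits of one-to-one sequences -/

/-- `p` is the limit of a one-to-one sequence. -/
def IsInjectiveLimit {X : Type*} [TopologicalSpace X] (p : X) : Prop :=
  ∃ y : ℕ → X, Function.Injective y ∧ Tendsto y atTop (𝓝 p)

theorem exists_subseq_tendsto_of_inFinBW {M X : Type*} [Countable M] [Infinite M]
    [TopologicalSpace X] {I : Order.Ideal (Set M)} (hI : IsIdealOn I) (h : InFinBW I X)
    (y : ℕ → X) : ∃ g : ℕ → ℕ, Function.Injective g ∧ ∃ p, Tendsto (y ∘ g) atTop (𝓝 p) := by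
  obtain ⟨e⟩ := nonempty_equiv_of_countable (α := M) (β := ℕ)
  obtain ⟨A, hA, p, hp⟩ := h.2 fun m => y (e m)
  have hinf : A.Infinite := fun hf => hA (hI.mem_of_finite A hf)
  let g := hinf.natEmbedding
  refine ⟨fun n => e (g n), fun a b hab => ?_, p, ?_⟩
  · exact g.injective (Subtype.ext (e.injective hab))
  · rw [tendsto_nhds]
    intro U hU hpU
    have hfin := (hp U hU hpU).preimage
      (f := fun n => ((g n : A) : M)) (fun a _ b _ hab => g.injective (Subtype.ext hab))
    rw [← Nat.cofinite_eq_atTop, mem_cofinite]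
    refine hfin.subset fun n hn => ?_
    exact ⟨(g n).2, hn⟩

theorem exists_isInjectiveLimit_of_infinite {M X : Type*} [Countable M] [Infinite M]
    [TopologicalSpace X] {I : Order.Ideal (Set M)} (hI : IsIdealOn I) (h : InFinBW I X)
    {W : Set X} (hW : W.Infinite) :
    ∃ p, IsInjectiveLimit p ∧ ∀ U : Set X, IsOpen U → p ∈ U → (U ∩ W).Nonempty := by
  obtain ⟨g, hg, p, hp⟩ := exists_subseq_tendsto_of_inFinBW hI h fun n => (hW.natEmbedding _ n : X)
  refine ⟨p, ⟨_, fun a b hab => ?_, hp⟩, fun U hU hpU => ?_⟩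
  · exact hg ((hW.natEmbedding _).injective (Subtype.ext hab))
  · obtain ⟨n, hn⟩ := (hp.eventually (hU.mem_nhds hpU)).exists
    exact ⟨_, hn, Subtype.coe_prop _⟩

/-- Near a limit `q` isolated from the others, any neighbourhood of `q` omits only finitely many
values of the sequence, so avoiding initial segments of values replaces a countable base. -/
theorem IsHindman.of_finite_isInjectiveLimit {M X : Type*} [Countable M] [Infinite M]
    [TopologicalSpace X] {I : Order.Ideal (Set M)} (hI : IsIdealOn I) (h : InFinBW I X)
    (hL : {p : X | IsInjectiveLimit p}.Finite) : IsHindman X := by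
  have := h.1
  intro x
  obtain ⟨U, hU⟩ := exists_ultrafilter_finiteSums
  by_cases hfib : ∃ y, x ⁻¹' {y} ∈ U
  · obtain ⟨y, hy⟩ := hfib
    obtain ⟨D, hD, hDA⟩ := hU (fun _ => x ⁻¹' {y}) fun _ => hy
    obtain ⟨m, hm⟩ := hDA 0
    refine ⟨y, D, hD, fun V _ hyV => ⟨m, fun n hn => ?_⟩⟩
    rw [show x n = y from hm hn]
    exact hyV
  push Not at hfib
  have hfinite : ∀ W : Set X, W.Finite → (x ⁻¹' W)ᶜ ∈ U := by
    intro W hW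
    have : (x ⁻¹' W)ᶜ = ⋂ y ∈ W, (x ⁻¹' {y})ᶜ := by
      ext n
      simp only [Set.mem_compl_iff, Set.mem_preimage, Set.mem_iInter, Set.mem_singleton_iff]
      exact ⟨fun h i hi e => h (e ▸ hi), fun h h' => h _ h' rfl⟩
    rw [this]
    exact (biInter_mem hW).2 fun y _ => Ultrafilter.compl_mem_iff_notMem.2 (hfib y)
  -- Otherwise removing a bad neighbourhood of each of the finitely many limits leaves an infinite
  -- set, which must accumulate at one of them.
  have hq : ∃ q, IsInjectiveLimit q ∧ ∀ V : Set X, IsOpen V → q ∈ V → x ⁻¹' V ∈ U := by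
    by_contra! hcon
    choose! V hVo hVm hVU using hcon
    have hmem : (x ⁻¹' ⋂ p ∈ {p : X | IsInjectiveLimit p}, (V p)ᶜ) ∈ U := by
      simp only [Set.preimage_iInter]
      exact (biInter_mem hL).2 fun p hp => Ultrafilter.compl_mem_iff_notMem.2 (hVU p hp)
    have hinf : (⋂ p ∈ {p : X | IsInjectiveLimit p}, (V p)ᶜ).Infinite := fun hf =>
      Ultrafilter.compl_mem_iff_notMem.1 (hfinite _ hf) hmem
    obtain ⟨p, hp, hpW⟩ := exists_isInjectiveLimit_of_infinite hI h hinf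
    obtain ⟨z, hz1, hz2⟩ := hpW (V p) (hVo p hp) (hVm p hp)
    exact Set.mem_iInter₂.1 hz2 p hp hz1
  obtain ⟨q, hqL, hq⟩ := hq
  have hsep : ∃ N : Set X, IsOpen N ∧ q ∈ N ∧ ∀ p, IsInjectiveLimit p → p ≠ q →
      ∃ O : Set X, IsOpen O ∧ p ∈ O ∧ Disjoint N O := by
    have : ∀ p, p ≠ q → ∃ O O' : Set X, IsOpen O ∧ IsOpen O' ∧ q ∈ O ∧ p ∈ O' ∧ Disjoint O O' :=
      fun p hp => t2_separation hp.symm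
    choose! O O' h1 h2 h3 h4 h5 using this
    have hfin : ({p : X | IsInjectiveLimit p} \ {q}).Finite := hL.subset Set.sdiff_subset
    refine ⟨⋂ p ∈ {p : X | IsInjectiveLimit p} \ {q}, O p,
      hfin.isOpen_biInter fun p hp => h1 p hp.2, Set.mem_iInter₂.2 fun p hp => h3 p hp.2,
      fun p hp hpq => ⟨O' p, h2 p hpq, h4 p hpq, ?_⟩⟩
    exact (h5 p hpq).mono_left (Set.biInter_subset_of_mem (show p ∈ _ from ⟨hp, hpq⟩))
  obtain ⟨N, hNo, hqN, hN⟩ := hsep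
  obtain ⟨D, hD, hDA⟩ := hU (fun k => x ⁻¹' N ∩ (x ⁻¹' (x '' Set.Iio k))ᶜ) fun k =>
    inter_mem (hq N hNo hqN) (hfinite _ ((Set.finite_Iio k).image x))
  refine ⟨q, D, hD, fun V hV hqV => ?_⟩
  have hfin : ((N ∩ Set.range x) \ V).Finite := by
    by_contra hinf
    obtain ⟨p, hp, hpW⟩ := exists_isInjectiveLimit_of_infinite hI h hinf
    by_cases hpq : p = q
    · subst hpq
      obtain ⟨z, hz1, hz2⟩ := hpW V hV hqV
      exact hz2.2 hz1
    · obtain ⟨O, hO, hpO, hd⟩ := hN p hp hpq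
      obtain ⟨z, hz1, hz2⟩ := hpW O hO hpO
      exact Set.disjoint_left.1 hd hz2.1.1 hz1
  have hk : ∃ k, (N ∩ Set.range x) \ V ⊆ x '' Set.Iio k := by
    obtain ⟨T, -, hT, hTN⟩ := Set.Finite.exists_subset_finite_image_eq hfin
      (show _ ⊆ x '' Set.univ from fun z hz => Set.image_univ ▸ hz.1.2)
    obtain ⟨k, hk⟩ := hT.bddAbove
    exact ⟨k + 1, hTN ▸ Set.image_mono fun n hn => Nat.lt_succ_of_le (hk hn)⟩
  obtain ⟨k, hk⟩ := hk
  obtain ⟨m, hm⟩ := hDA k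
  refine ⟨m, fun n hn => ?_⟩
  by_contra hnV
  exact (hm hn).2 (hk ⟨⟨(hm hn).1, n, rfl⟩, hnV⟩)

/-! ### Boring ideals -/

theorem exists_notMem_BIdeal_of_isBoring {M X : Type*} [TopologicalSpace X]
    {I : Order.Ideal (Set M)} (hI : IsBoring I) (h : InFinBW I X) (x : ℕ × ℕ × ℕ → X) :
    ∃ A ∉ BIdeal, ∃ p : X, ∀ U : Set X, IsOpen U → p ∈ U → {n ∈ A | x n ∉ U}.Finite := by
  obtain ⟨f, hf, hfI⟩ := hI
  obtain ⟨B, hB, p, hp⟩ := h.2 (x ∘ f)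
  refine ⟨f '' B, fun hmem => hB ?_, p, fun U hU hpU => ?_⟩
  · simpa [Set.preimage_image_eq B hf.1] using hfI _ hmem
  · refine ((hp U hU hpU).image f).subset ?_
    rintro _ ⟨⟨m, hm, rfl⟩, hn⟩
    exact ⟨m, ⟨hm, hn⟩, rfl⟩

/-- Let `(i, n, j) ↦ z i n` converge to `r` along `A`. A column over `(i, n)` is finite unless `z i
n = r`, which happens for at most one `n` per `i`. For large `i` neither `p i` nor any `z i n`
equals `r`, so the whole section is finite. -/
theorem finite_setOf_isInjectiveLimit {M X : Type*} [TopologicalSpace X]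
    {I : Order.Ideal (Set M)} (hI : IsBoring I) (h : InFinBW I X) :
    {p : X | IsInjectiveLimit p}.Finite := by
  have := h.1
  by_contra hinf
  have hinf : {p : X | IsInjectiveLimit p}.Infinite := hinf
  let p : ℕ → X := fun i => hinf.natEmbedding _ i
  have hpinj : Function.Injective p := fun a b hab =>
    (hinf.natEmbedding _).injective (Subtype.ext hab)
  have hpL : ∀ i, IsInjectiveLimit (p i) := fun i => (hinf.natEmbedding _ i).2
  choose y hy hyp using hpL
  obtain ⟨code, hcode⟩ := Set.countable_iff_exists_injOn.1
    (Set.countable_iUnion fun i => Set.countable_range (y i))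
  -- Passing to tails with codes at least `i` ensures that a fixed point `r` is a value of `z i`
  -- only for `i ≤ code r`.
  have htail : ∀ i, ∃ N, ∀ n, N ≤ n → i ≤ code (y i n) := by
    intro i
    have hfin : {n | code (y i n) < i}.Finite := by
      refine Set.Finite.preimage (f := fun n => code (y i n)) (s := Set.Iio i) ?_ (Set.finite_Iio i)
      intro a _ b _ hab
      exact hy i (hcode (Set.mem_iUnion.2 ⟨i, a, rfl⟩) (Set.mem_iUnion.2 ⟨i, b, rfl⟩) hab)
    obtain ⟨N, hN⟩ := hfin.bddAbove
    refine ⟨N + 1, fun n hn => ?_⟩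
    by_contra hlt
    have := hN (show n ∈ {n | code (y i n) < i} from not_le.1 hlt)
    omega
  choose N hN using htail
  let z : ℕ → ℕ → X := fun i n => y i (n + N i)
  have hz : ∀ i, Function.Injective (z i) := fun i a b hab => by
    have := hy i hab
    omega
  have hzp : ∀ i, Tendsto (z i) atTop (𝓝 (p i)) := fun i =>
    (hyp i).comp (tendsto_add_atTop_nat (N i))
  obtain ⟨A, hA, r, hr⟩ := exists_notMem_BIdeal_of_isBoring hI h fun a => z a.1 a.2.1
  have hcol : ∀ i n, z i n ≠ r → {j | (i, n, j) ∈ A}.Finite := by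
    intro i n hne
    have := hr {z i n}ᶜ isOpen_compl_singleton hne.symm
    refine (this.preimage (f := fun j => (i, n, j)) (fun a _ b _ hab => by simpa using hab)).subset ?_
    intro j hj
    exact ⟨hj, by simp⟩
  apply hA
  have hk : ∃ k, ∀ i, k ≤ i → p i ≠ r ∧ ∀ n, z i n ≠ r := by
    have h1 : ∃ k, ∀ i, k ≤ i → p i ≠ r := by
      by_cases hri : ∃ i, p i = r
      · obtain ⟨i, hi⟩ := hri
        refine ⟨i + 1, fun j hj hjr => ?_⟩
        have := hpinj (hjr.trans hi.symm)
        omega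
      · push Not at hri
        exact ⟨0, fun i _ => hri i⟩
    obtain ⟨k, hk⟩ := h1
    refine ⟨max k (code r + 1), fun i hi => ⟨hk i (le_trans (le_max_left _ _) hi), fun n hn => ?_⟩⟩
    have h1 := hN i (n + N i) (by omega)
    have h2 : code (y i (n + N i)) = code r := by rw [← hn]
    have h3 := le_trans (le_max_right _ _) hi
    omega
  obtain ⟨k, hk⟩ := hk
  refine ⟨k, fun i _ => ?_, fun i hi => ?_⟩
  · refine Set.Subsingleton.finite ?_
    intro a ha b hb
    have ha' : z i a = r := by
      by_contra hne; exact ha (hcol i a hne)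
    have hb' : z i b = r := by
      by_contra hne; exact hb (hcol i b hne)
    exact hz i (ha'.trans hb'.symm)
  · obtain ⟨hpr, hzr⟩ := hk i hi
    obtain ⟨V, W, hV, hW, hpV, hrW, hVW⟩ := t2_separation hpr
    obtain ⟨n₀, hn₀⟩ := eventually_atTop.1 ((hzp i).eventually (hV.mem_nhds hpV))
    have h1 : {q : ℕ × ℕ | (i, q) ∈ A ∧ z i q.1 ∉ W}.Finite :=
      (hr W hW hrW).preimage (f := fun q : ℕ × ℕ => (i, q)) (fun a _ b _ hab => by simpa using hab)
    have h2 : (⋃ n ∈ Set.Iio n₀, (fun j => (n, j)) '' {j | (i, n, j) ∈ A}).Finite :=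
      (Set.finite_Iio n₀).biUnion fun n _ => (hcol i n (hzr n)).image _
    refine (h1.union h2).subset ?_
    rintro ⟨n, j⟩ hnj
    by_cases hn : n < n₀
    · right
      simp only [Set.mem_iUnion]
      exact ⟨n, hn, j, hnj, rfl⟩
    · left
      exact ⟨hnj, fun hzW => Set.disjoint_left.1 hVW (hn₀ n (not_lt.1 hn)) hzW⟩

/-- The spaces in `FinBW(I)` are Hindman for boring `I`. -/
theorem IsHindman.of_isBoring {M X : Type*} [Countable M] [Infinite M] [TopologicalSpace X]
    {I : Order.Ideal (Set M)} (hI : IsIdealOn I) (hb : IsBoring I) (h : InFinBW I X) :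
    IsHindman X :=
  .of_finite_isInjectiveLimit hI h (finite_setOf_isInjectiveLimit hb h)

/-- Use `(i, n, j) ↦ (a i, a n)`: the first coordinate of a limit permits only one infinite section,
and the second only one infinite column in it. -/
theorem not_inFinBW_prod_of_isBoring {M Y : Type*} [TopologicalSpace Y] [Infinite Y]
    {I : Order.Ideal (Set M)} (hI : IsBoring I) : ¬ InFinBW I (Y × Y) := by
  intro h
  obtain ⟨y₀⟩ := (inferInstance : Nonempty Y)
  have := h.1
  have : T2Space Y := (isEmbedding_prodMkLeft y₀).t2Space
  let a := Infinite.natEmbedding Y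
  obtain ⟨A, hA, r, hr⟩ := exists_notMem_BIdeal_of_isBoring hI h fun t => (a t.1, a t.2.1)
  apply hA
  have hk : ∃ k, ∀ i, k ≤ i → a i ≠ r.1 := by
    by_cases hri : ∃ i, a i = r.1
    · obtain ⟨i, hi⟩ := hri
      refine ⟨i + 1, fun j hj hjr => ?_⟩
      have := a.injective (hjr.trans hi.symm)
      omega
    · push Not at hri
      exact ⟨0, fun i _ => hri i⟩
  obtain ⟨k, hk⟩ := hk
  refine ⟨k, fun i _ => ?_, fun i hi => ?_⟩
  · have key : ∀ n, ¬ {j : ℕ | (n, j) ∈ {q : ℕ × ℕ | (i, q) ∈ A}}.Finite → a n = r.2 := by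
      intro n hn
      by_contra hne
      have := hr (Prod.snd ⁻¹' {a n}ᶜ) (isOpen_compl_singleton.preimage continuous_snd)
        (Ne.symm hne)
      refine hn ((this.preimage (f := fun j => (i, n, j))
        (fun a _ b _ hab => by simpa using hab)).subset ?_)
      intro j hj
      exact ⟨hj, by simp⟩
    exact Set.Subsingleton.finite fun b hb c hc =>
      a.injective ((key b hb).trans (key c hc).symm)
  · have := hr (Prod.fst ⁻¹' {a i}ᶜ) (isOpen_compl_singleton.preimage continuous_fst)
      (hk i hi).symm
    refine (this.preimage (f := fun q : ℕ × ℕ => (i, q))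
      (fun a _ b _ hab => by simpa using hab)).subset ?_
    intro q hq
    exact ⟨hq, by simp⟩

/-! ### Embedding BI into an ideal -/

theorem Order.Ideal.union_mem {M : Type*} {I : Order.Ideal (Set M)} {A B : Set M} (hA : A ∈ I)
    (hB : B ∈ I) : A ∪ B ∈ I :=
  Order.Ideal.sup_mem hA hB

theorem Order.Ideal.mem_of_subset {M : Type*} {I : Order.Ideal (Set M)} {A B : Set M} (h : A ⊆ B)
    (hB : B ∈ I) : A ∈ I :=
  I.lower h hB

theorem Order.Ideal.biUnion_mem {M ι : Type*} {I : Order.Ideal (Set M)} {s : Set ι}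
    (hs : s.Finite) {f : ι → Set M} (hf : ∀ i ∈ s, f i ∈ I) : ⋃ i ∈ s, f i ∈ I := by
  induction s, hs using Set.Finite.induction_on with
  | empty => simpa using I.bot_mem
  | insert _ _ ih =>
    rw [Set.biUnion_insert]
    exact I.union_mem (hf _ (Set.mem_insert _ _)) (ih fun i hi => hf i (Set.mem_insert_of_mem _ hi))

theorem mem_FinSquared_of_finite {A : Set (ℕ × ℕ)} (hA : A.Finite) : A ∈ FinSquared := by
  have : {n : ℕ | ¬ {j : ℕ | (n, j) ∈ A}.Finite} = ∅ := by
    refine Set.eq_empty_of_forall_notMem fun n hn => hn ?_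
    exact hA.preimage (f := fun j => (n, j)) fun a _ b _ hab => by simpa using hab
  exact (congrArg Set.Finite this).mpr Set.finite_empty

theorem mem_BIdeal_of_subset_section {A : Set (ℕ × ℕ × ℕ)} (i : ℕ) (hA : ∀ a ∈ A, a.1 = i)
    (hi : {p : ℕ × ℕ | (i, p) ∈ A} ∈ FinSquared) : A ∈ BIdeal := by
  have hempty : ∀ k, k ≠ i → {p : ℕ × ℕ | (k, p) ∈ A} = ∅ := fun k hk =>
    Set.eq_empty_of_forall_notMem fun p hp => hk (hA _ hp)
  refine ⟨i + 1, fun k _ => ?_, fun k hk => ?_⟩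
  · by_cases hki : k = i
    · exact hki ▸ hi
    · rw [hempty k hki]
      exact mem_FinSquared_of_finite Set.finite_empty
  · rw [hempty k (by omega)]
    exact Set.finite_empty

theorem exists_infinite_subset_mem_BIdeal {S : Set (ℕ × ℕ × ℕ)} (hS : S.Infinite) :
    ∃ T ⊆ S, T.Infinite ∧ T ∈ BIdeal := by
  by_cases h : ∀ i, {p : ℕ × ℕ | (i, p) ∈ S}.Finite
  · exact ⟨S, subset_rfl, hS, 0, by simp, fun i _ => h i⟩
  push Not at h
  obtain ⟨i, hi⟩ := h
  by_cases hn : ∀ n, {j : ℕ | (i, n, j) ∈ S}.Finite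
  · refine ⟨Prod.mk i '' {p : ℕ × ℕ | (i, p) ∈ S}, ?_, hi.image (Prod.mk_right_injective i).injOn,
      mem_BIdeal_of_subset_section i ?_ ?_⟩
    · rintro _ ⟨p, hp, rfl⟩
      exact hp
    · rintro _ ⟨p, hp, rfl⟩
      rfl
    · simp [FinSquared, Set.not_infinite.2 (hn _)]
  · push Not at hn
    obtain ⟨n, hn⟩ := hn
    refine ⟨(fun j => (i, n, j)) '' {j : ℕ | (i, n, j) ∈ S}, ?_,
      hn.image fun a _ b _ hab => by simpa using hab, mem_BIdeal_of_subset_section i ?_ ?_⟩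
    · rintro _ ⟨p, hp, rfl⟩
      exact hp
    · rintro _ ⟨p, hp, rfl⟩
      rfl
    · refine (Set.finite_singleton n).subset fun n' hn' => ?_
      by_contra hne
      refine hn' ?_
      convert Set.finite_empty
      ext j
      simp only [Set.mem_image, Set.mem_ofPred_eq, Prod.mk.injEq, Set.mem_empty_iff_false, iff_false]
      rintro ⟨_, _, _, h, _⟩
      exact hne h.symm

/-- Take an infinite `T` in `BIdeal` inside the range of `φ`. Its preimage belongs to `I`, so `φ`
can be redefined there, at no cost, to cover everything missed. -/
theorem isBoring_of_injective {M : Type*} [Countable M] [Infinite M] {I : Order.Ideal (Set M)}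
    {φ : M → ℕ × ℕ × ℕ} (hφ : Function.Injective φ) (h : ∀ A ∈ BIdeal, φ ⁻¹' A ∈ I) :
    IsBoring I := by
  classical
  obtain ⟨T, hTr, hT, hTB⟩ := exists_infinite_subset_mem_BIdeal (Set.infinite_range_of_injective hφ)
  let S : Set M := φ ⁻¹' T
  have hS : S.Infinite := hT.preimage hTr
  have hR : ((φ '' Sᶜ)ᶜ).Infinite := by
    refine hT.mono ?_
    rintro _ ht ⟨m, hm, rfl⟩
    exact hm ht
  have := hS.to_subtype
  have := hR.to_subtype
  obtain ⟨e⟩ := nonempty_equiv_of_countable (α := S) (β := ((φ '' Sᶜ)ᶜ : Set _))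
  let f : M → ℕ × ℕ × ℕ := fun m => if hm : m ∈ S then (e ⟨m, hm⟩ : ℕ × ℕ × ℕ) else φ m
  have hfS : ∀ m (hm : m ∈ S), f m = e ⟨m, hm⟩ := fun m hm => dif_pos hm
  have hfn : ∀ m, m ∉ S → f m = φ m := fun m hm => dif_neg hm
  refine ⟨f, ⟨fun a b hab => ?_, fun y => ?_⟩, fun A hA => ?_⟩
  · by_cases ha : a ∈ S <;> by_cases hb : b ∈ S
    · rw [hfS a ha, hfS b hb] at hab
      simpa using e.injective (Subtype.ext hab)
    · rw [hfS a ha, hfn b hb] at hab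
      exact ((e ⟨a, ha⟩).2 ⟨b, hb, hab.symm⟩).elim
    · rw [hfn a ha, hfS b hb] at hab
      exact ((e ⟨b, hb⟩).2 ⟨a, ha, hab⟩).elim
    · rw [hfn a ha, hfn b hb] at hab
      exact hφ hab
  · by_cases hy : y ∈ φ '' Sᶜ
    · obtain ⟨m, hm, rfl⟩ := hy
      exact ⟨m, hfn m hm⟩
    · refine ⟨(e.symm ⟨y, hy⟩ : S), ?_⟩
      rw [hfS _ (Subtype.coe_prop _)]
      simp
  · refine I.mem_of_subset ?_ (I.union_mem (h A hA) (h T hTB))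
    intro m hm
    by_cases hmS : m ∈ S
    · exact Or.inr hmS
    · left
      rwa [Set.mem_preimage, hfn m hmS] at hm

/-! ### Settled sequences and the dichotomy for unboring ideals -/

/-- `t` is finite-to-one on `B`. -/
def FiniteToOneOn {M Y : Type*} (t : M → Y) (B : Set M) : Prop :=
  ∀ c, {m ∈ B | t m = c}.Finite

theorem FiniteToOneOn.mono {M Y : Type*} {t : M → Y} {B C : Set M} (h : FiniteToOneOn t B)
    (hC : C ⊆ B) : FiniteToOneOn t C :=
  fun c => (h c).subset fun _ hm => ⟨hC hm.1, hm.2⟩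

theorem FiniteToOneOn.finite_preimage {M Y : Type*} {t : M → Y} {B : Set M}
    (h : FiniteToOneOn t B) {F : Set Y} (hF : F.Finite) : {m ∈ B | t m ∈ F}.Finite := by
  refine (hF.biUnion fun c _ => h c).subset fun m hm => ?_
  simp only [Set.mem_iUnion]
  exact ⟨t m, hm.2, hm.1, rfl⟩

/-- The sequence coded by `t : M → ℕ ⊕ ℕ` (left values are points of `ω`, right values name other
points) has an `I`-positive subsequence that is constant, is finite-to-one and avoids `ω`, or is
finite-to-one with values in a member of `𝒜`. -/
def IsSettled {M : Type*} (I : Order.Ideal (Set M)) (𝒜 : Set (Set ℕ)) (t : M → ℕ ⊕ ℕ) : Prop :=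
  ∃ B ∉ I, (∃ c, ∀ m ∈ B, t m = c) ∨ (FiniteToOneOn t B ∧
    ((∀ m ∈ B, ∃ n, t m = Sum.inr n) ∨ ∃ A ∈ 𝒜, ∀ m ∈ B, ∃ n ∈ A, t m = Sum.inl n))

theorem IsSettled.mono {M : Type*} {I : Order.Ideal (Set M)} {𝒜 ℬ : Set (Set ℕ)} {t : M → ℕ ⊕ ℕ}
    (h : IsSettled I 𝒜 t) (hℬ : 𝒜 ⊆ ℬ) : IsSettled I ℬ t := by
  obtain ⟨B, hB, h | ⟨hf, h | ⟨A, hA, h⟩⟩⟩ := h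
  · exact ⟨B, hB, Or.inl h⟩
  · exact ⟨B, hB, Or.inr ⟨hf, Or.inl h⟩⟩
  · exact ⟨B, hB, Or.inr ⟨hf, Or.inr ⟨A, hℬ hA, h⟩⟩⟩

/-- `E` is the range of an `I`-positive finite-to-one subsequence of `t` and is almost disjoint
from the members of `𝒜`. -/
def IsNewLimit {M : Type*} (I : Order.Ideal (Set M)) (𝒜 : Set (Set ℕ)) (t : M → ℕ ⊕ ℕ)
    (E : Set ℕ) : Prop :=
  (∃ B ∉ I, FiniteToOneOn t B ∧ t '' B = Sum.inl '' E) ∧ ∀ A ∈ 𝒜, (A ∩ E).Finite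

/-- If both alternatives fail, layering `M` by the first `a k` met and then by the value of `t`
pulls BI back into `I`. Failure to settle handles the low layers; failure of a new limit handles the
union of the high ones. -/
theorem isSettled_or_exists_isNewLimit {M : Type*} [Countable M] [Infinite M]
    {I : Order.Ideal (Set M)} (hu : IsUnboring I) (a : ℕ → Set ℕ) (t : M → ℕ ⊕ ℕ) :
    IsSettled I (Set.range a) t ∨ ∃ E, IsNewLimit I (Set.range a) t E := by
  classical
  by_contra! hcon
  obtain ⟨hset, hnew⟩ := hcon
  apply hu
  have hfib : ∀ c, t ⁻¹' {c} ∈ I := fun c => by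
    by_contra hc
    exact hset ⟨_, hc, Or.inl ⟨c, fun m hm => hm⟩⟩
  have hright : ∀ B, FiniteToOneOn t B → (∀ m ∈ B, ∃ n, t m = Sum.inr n) → B ∈ I := by
    intro B hf hB
    by_contra hc
    exact hset ⟨_, hc, Or.inr ⟨hf, Or.inl hB⟩⟩
  have hleft : ∀ B k, FiniteToOneOn t B → (∀ m ∈ B, ∃ n ∈ a k, t m = Sum.inl n) → B ∈ I := by
    intro B k hf hB
    by_contra hc
    exact hset ⟨_, hc, Or.inr ⟨hf, Or.inr ⟨a k, ⟨k, rfl⟩, hB⟩⟩⟩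
  have horth : ∀ B, FiniteToOneOn t B → (∀ m ∈ B, ∃ n, t m = Sum.inl n) →
      (∀ k, (a k ∩ Sum.inl ⁻¹' (t '' B)).Finite) → B ∈ I := by
    intro B hf hB hk
    by_contra hc
    refine hnew (Sum.inl ⁻¹' (t '' B)) ⟨⟨B, hc, hf, ?_⟩, by rintro _ ⟨k, rfl⟩; exact hk k⟩
    rw [Set.image_preimage_eq_inter_range, Set.inter_eq_left.2]
    rintro _ ⟨m, hm, rfl⟩
    obtain ⟨n, hn⟩ := hB m hm
    exact ⟨n, hn.symm⟩
  obtain ⟨enc, henc⟩ := Countable.exists_injective_nat M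
  let code : ℕ ⊕ ℕ → ℕ := Encodable.encode
  have hcode : Function.Injective code := Encodable.encode_injective
  have hex : ∀ n : ℕ, ∃ k, n ∈ a k ∨ n = k := fun n => ⟨n, Or.inr rfl⟩
  -- Layer `0` holds the right values. The alternative `n = k` makes the layering total and adds
  -- only one value to layer `k + 1`.
  let σ : ℕ ⊕ ℕ → ℕ := Sum.elim (fun n => Nat.find (hex n) + 1) fun _ => 0
  have hσr : ∀ c, σ c = 0 → ∃ n, c = Sum.inr n := by
    rintro (n | n) h
    · simp [σ] at h
    · exact ⟨n, rfl⟩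
  have hσl : ∀ c k, σ c = k + 1 → ∃ n, c = Sum.inl n ∧ (n ∈ a k ∨ n = k) := by
    rintro (n | n) k h
    · have h' : Nat.find (hex n) = k := by simpa [σ] using h
      exact ⟨n, rfl, h' ▸ Nat.find_spec (hex n)⟩
    · simp [σ] at h
  have hσle : ∀ n k, n ∈ a k → σ (Sum.inl n) ≤ k + 1 := fun n k hn =>
    Nat.succ_le_succ (Nat.find_min' (hex n) (Or.inl hn))
  let φ : M → ℕ × ℕ × ℕ := fun m => (σ (t m), code (t m), enc m)
  have hφ : Function.Injective φ := fun m m' h => henc (by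
    have := congrArg (fun q => q.2.2) h
    exact this)
  refine isBoring_of_injective hφ fun A hA => ?_
  obtain ⟨k, hk1, hk2⟩ := hA
  -- The bound is raised to `k + 1` so that layer `0` is always low and `Q` below has only left
  -- values.
  have hk1' : ∀ i < k + 1, {p : ℕ × ℕ | (i, p) ∈ A} ∈ FinSquared := fun i hi => by
    by_cases hik : i < k
    · exact hk1 i hik
    · exact mem_FinSquared_of_finite (hk2 i (not_lt.1 hik))
  have hP : ∀ i < k + 1, {m | σ (t m) = i ∧ φ m ∈ A} ∈ I := by
    intro i hi
    let N : Set ℕ := {n : ℕ | ¬ {j : ℕ | (i, n, j) ∈ A}.Finite}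
    have hN : N.Finite := hk1' i hi
    let P : Set M := {m | σ (t m) = i ∧ φ m ∈ A ∧ code (t m) ∉ N}
    have hPf : FiniteToOneOn t P := by
      intro c
      by_cases hc : code c ∈ N
      · convert Set.finite_empty
        refine Set.eq_empty_of_forall_notMem ?_
        rintro m ⟨hm, rfl⟩
        exact hm.2.2 hc
      · have hfin : {j : ℕ | (i, code c, j) ∈ A}.Finite := by
          by_contra h
          exact hc h
        refine (hfin.preimage henc.injOn).subset ?_
        rintro m ⟨⟨h1, h2, -⟩, rfl⟩
        rw [← h1]
        exact h2
    have hPI : P ∈ I := by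
      rcases i with _ | i
      · exact hright P hPf fun m hm => hσr _ hm.1
      · refine I.mem_of_subset ?_ (I.union_mem (hfib (Sum.inl i))
          (hleft {m ∈ P | ∃ n ∈ a i, t m = Sum.inl n} i (hPf.mono fun m hm => hm.1)
            fun m hm => hm.2))
        intro m hm
        obtain ⟨n, hn, hna | rfl⟩ := hσl _ _ hm.1
        · exact Or.inr ⟨hm, n, hna, hn⟩
        · exact Or.inl hn
    refine I.mem_of_subset ?_ (I.union_mem hPI
      (I.biUnion_mem (hN.preimage hcode.injOn) fun c _ => hfib c))
    intro m hm
    by_cases hmN : code (t m) ∈ N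
    · right
      simp only [Set.mem_iUnion]
      exact ⟨t m, hmN, rfl⟩
    · exact Or.inl ⟨hm.1, hm.2, hmN⟩
  let Q : Set M := {m | k + 1 ≤ σ (t m) ∧ φ m ∈ A}
  have hQf : FiniteToOneOn t Q := by
    intro c
    by_cases hc : k + 1 ≤ σ c
    · refine ((hk2 (σ c) (by omega)).preimage (f := fun m => (φ m).2)
        fun m _ m' _ h => henc (congrArg Prod.snd h)).subset ?_
      rintro m ⟨hm, rfl⟩
      exact hm.2
    · convert Set.finite_empty
      refine Set.eq_empty_of_forall_notMem ?_
      rintro m ⟨hm, rfl⟩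
      exact hc hm.1
  -- Elements of `a j` lie in layers up to `j + 1`, so `a j` meets `t '' Q` through finitely many
  -- finite sections.
  have hQ : Q ∈ I := by
    refine horth Q hQf (fun m hm => ?_) fun j => ?_
    · obtain ⟨i, hi⟩ := Nat.exists_eq_add_of_le hm.1
      obtain ⟨n, hn, -⟩ := hσl (t m) (k + i) (by omega)
      exact ⟨n, hn⟩
    · have hfin : (⋃ i ∈ Set.Icc (k + 1) (j + 1),
          Prod.fst '' {p : ℕ × ℕ | (i, p) ∈ A}).Finite :=
        (Set.finite_Icc _ _).biUnion fun i hi => (hk2 i (by have := hi.1; omega)).image _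
      refine (hfin.preimage (hcode.comp Sum.inl_injective).injOn).subset ?_
      rintro n ⟨hna, m, hm, hmn⟩
      simp only [Set.mem_preimage, Set.mem_iUnion]
      refine ⟨σ (t m), ⟨hm.1, hmn ▸ hσle n j hna⟩, (code (t m), enc m), hm.2, ?_⟩
      simp [hmn]
  refine I.mem_of_subset ?_ (I.union_mem hQ (I.biUnion_mem (Set.finite_Iio (k + 1)) hP))
  intro m hm
  by_cases hmk : k + 1 ≤ σ (t m)
  · exact Or.inl ⟨hmk, hm⟩
  · right
    simp only [Set.mem_iUnion]
    exact ⟨σ (t m), not_le.1 hmk, rfl, hm⟩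

/-! ### Mrówka spaces: topology and FinBW -/

namespace MrowkaSpace

variable {𝒜 : Set (Set ℕ)}

theorem isOpen_iff {U : Set (MrowkaSpace 𝒜)} :
    IsOpen U ↔ (∀ A : 𝒜, mem A ∈ U → ∃ F : Finset ℕ, nhdMem A F ⊆ U) ∧
      (infty ∈ U → ∃ (G : Finset 𝒜) (F : Finset ℕ), nhdInfty G F ⊆ U) :=
  Iff.rfl

@[simp] theorem nat_mem_nhdMem {A : 𝒜} {F : Finset ℕ} {n : ℕ} :
    nat n ∈ nhdMem A F ↔ n ∈ (A : Set ℕ) ∧ n ∉ F := by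
  simp [nhdMem]

@[simp] theorem mem_mem_nhdMem {A B : 𝒜} {F : Finset ℕ} : mem B ∈ nhdMem A F ↔ B = A := by
  simp [nhdMem]

@[simp] theorem infty_notMem_nhdMem {A : 𝒜} {F : Finset ℕ} : infty ∉ nhdMem A F := by
  simp [nhdMem]

@[simp] theorem nat_mem_nhdInfty {G : Finset 𝒜} {F : Finset ℕ} {n : ℕ} :
    nat n ∈ nhdInfty G F ↔ n ∉ F ∧ ∀ A ∈ G, n ∉ (A : Set ℕ) := by
  simp [nhdInfty]

@[simp] theorem mem_mem_nhdInfty {G : Finset 𝒜} {F : Finset ℕ} {A : 𝒜} :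
    mem A ∈ nhdInfty G F ↔ A ∉ G := by
  simp [nhdInfty]

@[simp] theorem infty_mem_nhdInfty {G : Finset 𝒜} {F : Finset ℕ} :
    infty ∈ nhdInfty G F := by
  simp [nhdInfty]

theorem isOpen_singleton_nat (n : ℕ) : IsOpen ({nat n} : Set (MrowkaSpace 𝒜)) :=
  isOpen_iff.2 ⟨by simp, by simp⟩

theorem isOpen_nhdMem (A : 𝒜) (F : Finset ℕ) : IsOpen (nhdMem A F) :=
  isOpen_iff.2 ⟨fun B hB => ⟨F, by rw [mem_mem_nhdMem.1 hB]⟩, by simp⟩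

theorem isOpen_nhdInfty (h𝒜 : IsADFamily 𝒜) (G : Finset 𝒜) (F : Finset ℕ) :
    IsOpen (nhdInfty G F) := by
  refine isOpen_iff.2 ⟨fun B hB => ?_, fun _ => ⟨G, F, subset_rfl⟩⟩
  have hB : B ∉ G := by simpa using hB
  have hfin : (⋃ A ∈ (G : Set 𝒜), (A : Set ℕ) ∩ B).Finite :=
    G.finite_toSet.biUnion fun A hA => h𝒜.2 A A.2 B B.2 fun h => hB (Subtype.ext h ▸ hA)
  classical
  refine ⟨F ∪ hfin.toFinset, ?_⟩
  rintro (n | A | _) hx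
  · simp only [nat_mem_nhdMem, Finset.mem_union, Set.Finite.mem_toFinset, Set.mem_iUnion, not_or,
      not_exists] at hx
    exact nat_mem_nhdInfty.2 ⟨hx.2.1, fun A hA hn => hx.2.2 A hA ⟨hn, hx.1⟩⟩
  · rw [mem_mem_nhdMem] at hx
    simpa [hx] using hB
  · simp

theorem t2Space (h𝒜 : IsADFamily 𝒜) : T2Space (MrowkaSpace 𝒜) := by
  have nat_ne : ∀ (n : ℕ) (y : MrowkaSpace 𝒜), nat n ≠ y →
      ∃ V : Set (MrowkaSpace 𝒜), IsOpen V ∧ y ∈ V ∧ nat n ∉ V := by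
    rintro n (k | A | _) h
    · exact ⟨{nat k}, isOpen_singleton_nat k, rfl, h⟩
    · exact ⟨nhdMem A {n}, isOpen_nhdMem _ _, by simp, by simp⟩
    · exact ⟨nhdInfty ∅ {n}, isOpen_nhdInfty h𝒜 _ _, by simp, by simp⟩
  have nat_sep : ∀ (n : ℕ) (y : MrowkaSpace 𝒜), nat n ≠ y →
      ∃ U V : Set (MrowkaSpace 𝒜), IsOpen U ∧ IsOpen V ∧ nat n ∈ U ∧ y ∈ V ∧ Disjoint U V := by
    intro n y h
    obtain ⟨V, hV, hy, hn⟩ := nat_ne n y h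
    exact ⟨{nat n}, V, isOpen_singleton_nat n, hV, rfl, hy, Set.disjoint_singleton_left.2 hn⟩
  have mem_sep : ∀ A : 𝒜, ∃ U V : Set (MrowkaSpace 𝒜), IsOpen U ∧ IsOpen V ∧ mem A ∈ U ∧
      infty ∈ V ∧ Disjoint U V := by
    intro A
    refine ⟨nhdMem A ∅, nhdInfty {A} ∅, isOpen_nhdMem _ _, isOpen_nhdInfty h𝒜 _ _, by simp,
      by simp, Set.disjoint_left.2 ?_⟩
    rintro (n | B | _) h1 h2
    · simp at h1 h2
      exact h2 h1
    · simp at h1 h2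
      exact h2 h1
    · simp at h1
  have swap : ∀ x y : MrowkaSpace 𝒜, (∃ U V : Set (MrowkaSpace 𝒜), IsOpen U ∧ IsOpen V ∧ x ∈ U ∧
      y ∈ V ∧ Disjoint U V) → ∃ U V : Set (MrowkaSpace 𝒜), IsOpen U ∧ IsOpen V ∧ y ∈ U ∧
      x ∈ V ∧ Disjoint U V := by
    rintro x y ⟨U, V, hU, hV, hx, hy, h⟩
    exact ⟨V, U, hV, hU, hy, hx, h.symm⟩
  refine ⟨?_⟩
  rintro (n | A | _) y h
  · exact nat_sep n y h
  · rcases y with n | B | _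
    · exact swap _ _ (nat_sep n _ h.symm)
    · have hAB : (A : Set ℕ) ≠ B := fun e => h (congrArg mem (Subtype.ext e))
      refine ⟨nhdMem A ∅, nhdMem B (h𝒜.2 A A.2 B B.2 hAB).toFinset, isOpen_nhdMem _ _,
        isOpen_nhdMem _ _, by simp, by simp, Set.disjoint_left.2 ?_⟩
      rintro (n | C | _) h1 h2
      · simp at h1 h2
        exact h2.2 h1 h2.1
      · simp only [mem_mem_nhdMem] at h1 h2
        exact hAB (congrArg Subtype.val (h1.symm.trans h2))
      · simp at h1
    · exact mem_sep A
  · rcases y with n | B | _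
    · exact swap _ _ (nat_sep n _ h.symm)
    · exact swap _ _ (mem_sep B)
    · exact (h rfl).elim

/-- The three ways to be settled give a constant subsequence, one converging to `infty`, and one
converging to a member of `𝒜`. -/
theorem inFinBW {M : Type*} [Countable M] {I : Order.Ideal (Set M)} (h𝒜 : IsADFamily 𝒜)
    (h : ∀ t : M → ℕ ⊕ ℕ, IsSettled I 𝒜 t) : InFinBW I (MrowkaSpace 𝒜) := by
  refine ⟨t2Space h𝒜, fun x => ?_⟩
  obtain ⟨code, hcode⟩ := Set.countable_iff_exists_injOn.1 (Set.countable_range x)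
  let c : MrowkaSpace 𝒜 → ℕ ⊕ ℕ := fun y =>
    match y with
    | nat n => Sum.inl n
    | mem A => Sum.inr (code (mem A))
    | infty => Sum.inr (code infty)
  have hcl : ∀ y n, c y = Sum.inl n → y = nat n := by
    rintro (k | A | _) n h
    · exact congrArg nat (Sum.inl_injective h)
    · exact (Sum.inr_ne_inl h).elim
    · exact (Sum.inr_ne_inl h).elim
  have hcr : ∀ y n, c y = Sum.inr n → code y = n ∧ ∀ k, y ≠ nat k := by
    rintro (k | A | _) n h
    · exact (Sum.inl_ne_inr h).elim
    · exact ⟨Sum.inr_injective h, by simp⟩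
    · exact ⟨Sum.inr_injective h, by simp⟩
  have hinj : ∀ m m', c (x m) = c (x m') → x m = x m' := by
    intro m m' h
    rcases hm : c (x m') with n | n
    · rw [hcl _ _ hm, hcl _ _ (h.trans hm)]
    · exact hcode ⟨m, rfl⟩ ⟨m', rfl⟩ ((hcr _ _ (h.trans hm)).1.trans (hcr _ _ hm).1.symm)
  obtain ⟨B, hB, ⟨d, hd⟩ | ⟨hf, hr | ⟨A, hA, hl⟩⟩⟩ := h fun m => c (x m)
  · refine ⟨B, hB, ?_⟩
    rcases B.eq_empty_or_nonempty with rfl | ⟨m₀, hm₀⟩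
    · exact ⟨infty, by simp⟩
    · refine ⟨x m₀, fun U _ hU => ?_⟩
      convert Set.finite_empty
      refine Set.eq_empty_of_forall_notMem fun m hm => hm.2 ?_
      rwa [hinj m m₀ ((hd m hm.1).trans (hd m₀ hm₀).symm)]
  · refine ⟨B, hB, infty, fun U hU hi => ?_⟩
    obtain ⟨G, F, hGF⟩ := (isOpen_iff.1 hU).2 hi
    refine (hf.finite_preimage ((G.finite_toSet.image fun A => c (mem A)))).subset ?_
    rintro m ⟨hm, hmU⟩
    refine ⟨hm, ?_⟩
    obtain ⟨n, hn⟩ := hr m hm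
    have hnat := (hcr _ _ hn).2
    rcases hx : x m with k | A | _
    · exact (hnat k hx).elim
    · refine ⟨A, ?_, rfl⟩
      by_contra hAG
      exact hmU (hGF (by rw [hx]; simpa using hAG))
    · exact (hmU (hx ▸ hi)).elim
  · refine ⟨B, hB, mem ⟨A, hA⟩, fun U hU hAU => ?_⟩
    obtain ⟨F, hF⟩ := (isOpen_iff.1 hU).1 _ hAU
    refine (hf.finite_preimage ((F.finite_toSet.image Sum.inl))).subset ?_
    rintro m ⟨hm, hmU⟩
    refine ⟨hm, ?_⟩
    obtain ⟨n, hnA, hn⟩ := hl m hm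
    refine ⟨n, ?_, hn.symm⟩
    by_contra hnF
    exact hmU (hF (by rw [hcl _ _ hn]; simpa using ⟨hnA, hnF⟩))

end MrowkaSpace

/-! ### Dyadic levels and failure of the Hindman property -/

/-- The numbers whose `2`-adic valuation is `l`. -/
def dyadicLevel (l : ℕ) : Set ℕ := {n | 2 ^ l ∣ n ∧ ¬ 2 ^ (l + 1) ∣ n}

theorem exists_mem_dyadicLevel {n : ℕ} (hn : n ≠ 0) : ∃ l, n ∈ dyadicLevel l := by
  obtain ⟨l, m, hm, rfl⟩ := Nat.exists_eq_two_pow_mul_odd hn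
  refine ⟨l, dvd_mul_right _ _, fun h => ?_⟩
  rw [pow_succ] at h
  have := Nat.dvd_of_mul_dvd_mul_left (by positivity) h
  rw [← Nat.not_even_iff_odd] at hm
  exact hm (even_iff_two_dvd.2 this)

theorem mem_dyadicLevel_iff {n l : ℕ} : n ∈ dyadicLevel l ↔ ∃ k, n = 2 ^ l * (2 * k + 1) := by
  constructor
  · rintro ⟨⟨c, rfl⟩, h⟩
    rw [pow_succ] at h
    have hodd : ¬ 2 ∣ c := fun hc => h (Nat.mul_dvd_mul_left _ hc)
    obtain ⟨k, rfl⟩ : Odd c := by rwa [← Nat.not_even_iff_odd, even_iff_two_dvd]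
    exact ⟨k, rfl⟩
  · rintro ⟨k, rfl⟩
    refine ⟨dvd_mul_right _ _, fun h => ?_⟩
    rw [pow_succ] at h
    have := Nat.dvd_of_mul_dvd_mul_left (by positivity) h
    omega

theorem infinite_dyadicLevel (l : ℕ) : (dyadicLevel l).Infinite := by
  refine (Set.infinite_range_of_injective (f := fun k : ℕ => 2 ^ l * (2 * k + 1)) ?_).mono ?_
  · intro a b hab
    have := Nat.eq_of_mul_eq_mul_left (by positivity) hab
    omega
  · rintro _ ⟨k, rfl⟩
    exact mem_dyadicLevel_iff.2 ⟨k, rfl⟩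

theorem disjoint_dyadicLevel {l k : ℕ} (h : l ≠ k) : Disjoint (dyadicLevel l) (dyadicLevel k) := by
  wlog hlt : l < k generalizing l k
  · exact (this h.symm (by omega)).symm
  exact Set.disjoint_left.2 fun n hl hk => hl.2 ((pow_dvd_pow 2 hlt).trans hk.1)

theorem dyadicLevel_injective : Function.Injective dyadicLevel := by
  intro l k h
  by_contra hne
  have := disjoint_dyadicLevel hne
  rw [h, disjoint_self] at this
  exact (infinite_dyadicLevel k).nonempty.ne_empty this

theorem mem_finiteSums_of_mem {D : Set ℕ} {d : ℕ} (h : d ∈ D) : d ∈ finiteSums D :=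
  ⟨{d}, by simp, by simpa using h, by simp⟩

theorem add_mem_finiteSums {D : Set ℕ} {d e : ℕ} (hd : d ∈ D) (he : e ∈ D) (hne : d ≠ e) :
    d + e ∈ finiteSums D :=
  ⟨{d, e}, by simp, by simp [Set.insert_subset_iff, hd, he], Finset.sum_pair hne⟩

/-- No member of an almost disjoint family containing the dyadic levels contains all finite sums of
an infinite set. -/
theorem not_finiteSums_subset {𝒜 : Set (Set ℕ)} (h𝒜 : IsADFamily 𝒜)
    (hZ : ∀ l, dyadicLevel l ∈ 𝒜) {A : Set ℕ} (hA : A ∈ 𝒜) {D : Set ℕ} (hD : D.Infinite) :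
    ¬ finiteSums D ⊆ A := by
  intro hDA
  have hDA' : D ⊆ A := fun d hd => hDA (mem_finiteSums_of_mem hd)
  -- Two numbers of equal valuation have a sum of larger valuation, so a level cannot contain the
  -- sums.
  by_cases hAZ : ∃ l, A = dyadicLevel l
  · obtain ⟨l, rfl⟩ := hAZ
    obtain ⟨d, hd⟩ := hD.nonempty
    obtain ⟨e, he, hlt⟩ := hD.exists_gt d
    have h1 := hDA (add_mem_finiteSums hd he hlt.ne)
    obtain ⟨a, ha⟩ := mem_dyadicLevel_iff.1 (hDA' hd)
    obtain ⟨b, hb⟩ := mem_dyadicLevel_iff.1 (hDA' he)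
    refine h1.2 ⟨a + b + 1, ?_⟩
    rw [ha, hb]
    ring
  · push Not at hAZ
    obtain ⟨d, hd, hd0⟩ := hD.exists_gt 0
    obtain ⟨l, hl⟩ := exists_mem_dyadicLevel hd0.ne'
    -- All but finitely many `e ∈ D` have valuation above `l`; then `d + e` has valuation `l`,
    -- making `A ∩ dyadicLevel l` infinite.
    have hfin : (⋃ i ∈ Set.Iic l, A ∩ dyadicLevel i).Finite :=
      (Set.finite_Iic l).biUnion fun i _ => h𝒜.2 A hA _ (hZ i) (hAZ i)
    have hinf := hD.sdiff hfin
    have hsub : (fun e => d + e) '' (D \ ⋃ i ∈ Set.Iic l, A ∩ dyadicLevel i) ⊆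
        A ∩ dyadicLevel l := by
      rintro _ ⟨e, ⟨heD, he⟩, rfl⟩
      have hdvd : 2 ^ (l + 1) ∣ e := by
        rcases eq_or_ne e 0 with rfl | he0
        · exact dvd_zero _
        obtain ⟨i, hi⟩ := exists_mem_dyadicLevel he0
        by_cases hil : i ≤ l
        · refine (he ?_).elim
          simp only [Set.mem_iUnion]
          exact ⟨i, hil, hDA' heD, hi⟩
        · exact (pow_dvd_pow 2 (by omega)).trans hi.1
      have hne : d ≠ e := by
        rintro rfl
        exact hl.2 hdvd
      refine ⟨hDA (add_mem_finiteSums hd heD hne), ?_, fun h => ?_⟩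
      · exact dvd_add hl.1 ((pow_dvd_pow 2 (Nat.le_succ l)).trans hdvd)
      · exact hl.2 ((Nat.dvd_add_left hdvd).1 h)
    exact (hinf.image (add_right_injective d).injOn)
      ((h𝒜.2 A hA _ (hZ l) (hAZ l)).subset hsub)

/-- For the sequence of isolated points, the dyadic levels exclude limits in `𝒜` and maximality
excludes `infty`. -/
theorem MrowkaSpace.not_isHindman {𝒜 : Set (Set ℕ)} (h𝒜 : IsADFamily 𝒜)
    (hZ : ∀ l, dyadicLevel l ∈ 𝒜)
    (hmax : ∀ D : Set ℕ, D.Infinite → ∃ A ∈ 𝒜, (A ∩ D).Infinite) :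
    ¬ IsHindman (MrowkaSpace 𝒜) := by
  intro h
  obtain ⟨p, D, hD, hp⟩ := h MrowkaSpace.nat
  rcases p with k | A | _
  · obtain ⟨m, hm⟩ := hp {nat k} (isOpen_singleton_nat k) rfl
    obtain ⟨d, hd, hlt⟩ := hD.exists_gt (max m k)
    have h1 : nat d = nat k := hm d (mem_finiteSums_of_mem ⟨hd, by simp; omega⟩)
    injection h1
    omega
  · obtain ⟨m, hm⟩ := hp (nhdMem A ∅) (isOpen_nhdMem _ _) (by simp)
    refine not_finiteSums_subset h𝒜 hZ A.2 (hD.sdiff (Set.finite_Iic m)) fun n hn => ?_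
    exact (nat_mem_nhdMem.1 (hm n hn)).1
  · obtain ⟨A, hA, hAD⟩ := hmax D hD
    obtain ⟨m, hm⟩ := hp (nhdInfty {⟨A, hA⟩} ∅) (isOpen_nhdInfty h𝒜 _ _) (by simp)
    obtain ⟨d, hd, hlt⟩ := hAD.exists_gt m
    have := hm d (mem_finiteSums_of_mem ⟨hd.2, by simpa using hlt⟩)
    simp only [nat_mem_nhdInfty, Finset.mem_singleton] at this
    exact this.2 _ rfl hd.1

/-- Diagonalize: pick `d k > k` in the `k`-th set outside all earlier ones. -/
theorem exists_infinite_almostDisjoint {𝒜 : Set (Set ℕ)} (h𝒜 : IsADFamily 𝒜)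
    (hinf : 𝒜.Infinite) (hc : 𝒜.Countable) :
    ∃ D : Set ℕ, D.Infinite ∧ ∀ A ∈ 𝒜, (A ∩ D).Finite := by
  have := hinf.to_subtype
  have := hc.to_subtype
  obtain ⟨e⟩ := nonempty_equiv_of_countable (α := ℕ) (β := 𝒜)
  have hex : ∀ k, ∃ d, k < d ∧ d ∈ (e k : Set ℕ) ∧ ∀ j < k, d ∉ (e j : Set ℕ) := by
    intro k
    have hfin : (⋃ j ∈ Set.Iio k, (e k : Set ℕ) ∩ e j).Finite :=
      (Set.finite_Iio k).biUnion fun j hj => h𝒜.2 _ (e k).2 _ (e j).2 fun h =>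
        (ne_of_lt hj) (e.injective (Subtype.ext h)).symm
    obtain ⟨d, hd, hlt⟩ := ((h𝒜.1 _ (e k).2).sdiff hfin).exists_gt k
    refine ⟨d, hlt, hd.1, fun j hj hdj => hd.2 ?_⟩
    simp only [Set.mem_iUnion]
    exact ⟨j, hj, hd.1, hdj⟩
  choose d hd1 hd2 hd3 using hex
  refine ⟨Set.range d, fun hf => ?_, fun A hA => ?_⟩
  · obtain ⟨b, hb⟩ := hf.bddAbove
    have h1 := hb ⟨b, rfl⟩
    have h2 := hd1 b
    omega
  · obtain ⟨j, hj⟩ := e.surjective ⟨A, hA⟩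
    have hj : (e j : Set ℕ) = A := congrArg Subtype.val hj
    refine ((Set.finite_Iic j).image d).subset ?_
    rintro _ ⟨hA, k, rfl⟩
    refine ⟨k, ?_, rfl⟩
    by_contra hk
    exact hd3 k j (not_le.1 hk) (hj ▸ hA)

theorem MrowkaSpace.uncountable {𝒜 : Set (Set ℕ)} (h𝒜 : IsADFamily 𝒜)
    (hinf : 𝒜.Infinite) (hmax : ∀ D : Set ℕ, D.Infinite → ∃ A ∈ 𝒜, (A ∩ D).Infinite) :
    Uncountable (MrowkaSpace 𝒜) := by
  rw [← not_countable_iff]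
  intro hc
  have hinj : Function.Injective (MrowkaSpace.mem (𝒜 := 𝒜)) := fun A B h => by injection h
  obtain ⟨D, hD, hDA⟩ := exists_infinite_almostDisjoint h𝒜 hinf
    (Set.countable_coe_iff.1 hinj.countable)
  obtain ⟨A, hA, hAD⟩ := hmax D hD
  exact hAD (hDA A hA)

/-! ### The transfinite construction under CH -/

theorem exists_wellOrder_enumeration (hCH : Cardinal.continuum.{0} = Cardinal.aleph.{0} 1) :
    ∃ (ι : Type) (_ : LinearOrder ι) (_ : WellFoundedLT ι) (τ : ι → ℕ → ℕ ⊕ ℕ),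
      Function.Surjective τ ∧ ∀ i : ι, (Set.Iio i).Countable := by
  have hcard : Cardinal.mk (Cardinal.aleph.{0} 1).ord.ToType = Cardinal.mk (ℕ → ℕ ⊕ ℕ) := by
    rw [Cardinal.mk_ord_toType, ← hCH]
    simp
  obtain ⟨e⟩ := Cardinal.eq.1 hcard
  refine ⟨_, inferInstance, inferInstance, e, e.surjective, fun i => ?_⟩
  have h := Cardinal.mk_Iio_lt i (by simp)
  rw [Cardinal.mk_ord_toType] at h
  have h' := h.trans_eq Cardinal.succ_aleph0.symm
  exact Cardinal.le_aleph0_iff_set_countable.1 (Order.lt_succ_iff.1 h')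

theorem IsNewLimit.infinite {M : Type*} {I : Order.Ideal (Set M)} (hI : IsIdealOn I)
    {𝒜 : Set (Set ℕ)} {t : M → ℕ ⊕ ℕ} {E : Set ℕ} (h : IsNewLimit I 𝒜 t E) : E.Infinite := by
  obtain ⟨⟨B, hB, hf, hE⟩, -⟩ := h
  intro hfin
  refine hB (hI.mem_of_finite B ((hf.finite_preimage (hfin.image Sum.inl)).subset fun m hm => ?_))
  exact ⟨hm, hE ▸ ⟨m, hm, rfl⟩⟩

theorem IsNewLimit.isSettled {M : Type*} {I : Order.Ideal (Set M)} {𝒜 ℬ : Set (Set ℕ)}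
    {t : M → ℕ ⊕ ℕ} {E : Set ℕ} (h : IsNewLimit I 𝒜 t E) (hE : E ∈ ℬ) : IsSettled I ℬ t := by
  obtain ⟨⟨B, hB, hf, hBE⟩, -⟩ := h
  refine ⟨B, hB, Or.inr ⟨hf, Or.inr ⟨E, hE, fun m hm => ?_⟩⟩⟩
  obtain ⟨n, hn, hnm⟩ : t m ∈ Sum.inl '' E := hBE ▸ ⟨m, hm, rfl⟩
  exact ⟨n, hn, hnm.symm⟩

theorem exists_adFamily_isSettled (hCH : Cardinal.continuum.{0} = Cardinal.aleph.{0} 1)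
    {M : Type*} [Countable M] [Infinite M] {I : Order.Ideal (Set M)} (hI : IsIdealOn I)
    (hu : IsUnboring I) :
    ∃ 𝒜 : Set (Set ℕ), IsADFamily 𝒜 ∧ (∀ l, dyadicLevel l ∈ 𝒜) ∧
      ∀ t : M → ℕ ⊕ ℕ, IsSettled I 𝒜 t := by
  classical
  obtain ⟨ι, _, _, τ, hτ, hcount⟩ := exists_wellOrder_enumeration hCH
  obtain ⟨e⟩ := nonempty_equiv_of_countable (α := M) (β := ℕ)
  -- The default `dyadicLevel 0` already belongs to the family, so such a stage adds nothing.
  let step : (M → ℕ ⊕ ℕ) → Set (Set ℕ) → Set ℕ := fun t 𝒞 =>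
    if h : ∃ E, IsNewLimit I 𝒞 t E then h.choose else dyadicLevel 0
  let A : ι → Set ℕ := (wellFounded_lt (α := ι)).fix fun i prev =>
    step (τ i ∘ e) (Set.range dyadicLevel ∪ {S | ∃ j, ∃ h : j < i, prev j h = S})
  let prev : ι → Set (Set ℕ) := fun i => Set.range dyadicLevel ∪ A '' Set.Iio i
  have hA : ∀ i, A i = step (τ i ∘ e) (prev i) := by
    intro i
    have h1 : A i = step (τ i ∘ e) (Set.range dyadicLevel ∪ {S | ∃ j, ∃ _ : j < i, A j = S}) :=
      (wellFounded_lt (α := ι)).fix_eq _ i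
    rw [h1]
    congr 2
    ext S
    simp
  have hnew : ∀ i, (∃ E, IsNewLimit I (prev i) (τ i ∘ e) E) →
      IsNewLimit I (prev i) (τ i ∘ e) (A i) := by
    intro i h
    rw [hA i]
    simp only [step, dif_pos h]
    exact h.choose_spec
  have hcases : ∀ i, A i = dyadicLevel 0 ∨ IsNewLimit I (prev i) (τ i ∘ e) (A i) := by
    intro i
    by_cases h : ∃ E, IsNewLimit I (prev i) (τ i ∘ e) E
    · exact Or.inr (hnew i h)
    · left
      rw [hA i]
      simp only [step, dif_neg h]
  have hZA : ∀ l i, dyadicLevel l ≠ A i → (dyadicLevel l ∩ A i).Finite := by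
    intro l i hne
    rcases hcases i with h | h
    · rw [h] at hne ⊢
      have := disjoint_dyadicLevel fun hl => hne (congrArg dyadicLevel hl)
      rw [this.inter_eq]
      exact Set.finite_empty
    · exact h.2 _ (Or.inl ⟨l, rfl⟩)
  have hAA : ∀ j i, j < i → A j ≠ A i → (A j ∩ A i).Finite := by
    intro j i hji hne
    rcases hcases i with h | h
    · rw [h] at hne ⊢
      rw [Set.inter_comm]
      exact hZA 0 j hne.symm
    · exact h.2 _ (Or.inr ⟨j, hji, rfl⟩)
  refine ⟨Set.range dyadicLevel ∪ Set.range A, ⟨?_, ?_⟩, fun l => Or.inl ⟨l, rfl⟩, fun t => ?_⟩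
  · rintro _ (⟨l, rfl⟩ | ⟨i, rfl⟩)
    · exact infinite_dyadicLevel l
    · rcases hcases i with h | h
      · rw [h]
        exact infinite_dyadicLevel 0
      · exact h.infinite hI
  · rintro _ (⟨l, rfl⟩ | ⟨i, rfl⟩) _ (⟨k, rfl⟩ | ⟨j, rfl⟩) hne
    · have := disjoint_dyadicLevel fun hl => hne (congrArg dyadicLevel hl)
      rw [this.inter_eq]
      exact Set.finite_empty
    · exact hZA l j hne
    · rw [Set.inter_comm]
      exact hZA k i hne.symm
    · rcases lt_trichotomy i j with h | rfl | h
      · exact hAA i j h hne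
      · exact (hne rfl).elim
      · rw [Set.inter_comm]
        exact hAA j i h hne.symm
  · obtain ⟨i, hi⟩ := hτ (t ∘ e.symm)
    have hit : τ i ∘ e = t := by
      rw [hi]
      ext m
      simp
    have hpc : (prev i).Countable := (Set.countable_range _).union ((hcount i).image _)
    obtain ⟨a, ha⟩ := hpc.exists_eq_range ⟨_, Or.inl ⟨0, rfl⟩⟩
    rcases isSettled_or_exists_isNewLimit hu a t with h | h
    · rw [← ha] at h
      exact h.mono (Set.union_subset_union_right _ (Set.image_subset_range _ _))
    · rw [← ha, ← hit] at h
      exact hit ▸ (hnew i h).isSettled (Or.inr ⟨i, rfl⟩)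

/-- Settling a one-to-one sequence in `D` can only happen inside a member of `𝒜`; thus settling all
sequences gives maximality. -/
theorem exists_infinite_inter_of_isSettled {M : Type*} [Countable M] {I : Order.Ideal (Set M)}
    (hI : IsIdealOn I) {𝒜 : Set (Set ℕ)} (h : ∀ t : M → ℕ ⊕ ℕ, IsSettled I 𝒜 t) {D : Set ℕ}
    (hD : D.Infinite) : ∃ A ∈ 𝒜, (A ∩ D).Infinite := by
  obtain ⟨enc, henc⟩ := Countable.exists_injective_nat M
  let g : M → ℕ := fun m => hD.natEmbedding _ (enc m)
  have hg : Function.Injective g := fun m m' hm =>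
    henc ((hD.natEmbedding _).injective (Subtype.ext hm))
  have hgD : ∀ m, g m ∈ D := fun m => (hD.natEmbedding _ (enc m)).2
  obtain ⟨B, hB, h⟩ := h fun m => Sum.inl (g m)
  have hBinf : B.Infinite := fun hf => hB (hI.mem_of_finite B hf)
  rcases h with ⟨c, hc⟩ | ⟨-, hr | ⟨A, hA, hl⟩⟩
  · refine (hBinf (Set.Subsingleton.finite fun a ha b hb => ?_)).elim
    exact hg (Sum.inl_injective ((hc a ha).trans (hc b hb).symm))
  · obtain ⟨m, hm⟩ := hBinf.nonempty
    obtain ⟨n, hn⟩ := hr m hm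
    exact (Sum.inl_ne_inr hn).elim
  · refine ⟨A, hA, (hBinf.image hg.injOn).mono ?_⟩
    rintro _ ⟨m, hm, rfl⟩
    obtain ⟨n, hnA, hn⟩ := hl m hm
    rw [Sum.inl_injective hn] at *
    exact ⟨hnA, Sum.inl_injective hn ▸ hgD m⟩

theorem exists_mrowkaSpace_of_isUnboring (hCH : Cardinal.continuum.{0} = Cardinal.aleph.{0} 1)
    {M : Type*} [Countable M] [Infinite M] {I : Order.Ideal (Set M)} (hI : IsIdealOn I)
    (hu : IsUnboring I) :
    ∃ 𝒜 : Set (Set ℕ), 𝒜.Infinite ∧ IsADFamily 𝒜 ∧ Uncountable (MrowkaSpace 𝒜) ∧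
      InFinBW I (MrowkaSpace 𝒜) ∧ ¬ IsHindman (MrowkaSpace 𝒜) := by
  obtain ⟨𝒜, had, hZ, hset⟩ := exists_adFamily_isSettled hCH hI hu
  have hinf : 𝒜.Infinite := (Set.infinite_range_of_injective dyadicLevel_injective).mono
    (Set.range_subset_iff.2 hZ)
  have hmax : ∀ D : Set ℕ, D.Infinite → ∃ A ∈ 𝒜, (A ∩ D).Infinite := fun D hD =>
    exists_infinite_inter_of_isSettled hI hset hD
  exact ⟨𝒜, hinf, had, MrowkaSpace.uncountable had hinf hmax, MrowkaSpace.inFinBW had hset,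
    MrowkaSpace.not_isHindman had hZ hmax⟩

/-! ### The main theorem -/

theorem mainTheorem9
    (hCH : Cardinal.continuum.{0} = Cardinal.aleph.{0} 1)
    (M : Type v) [Countable M] [Infinite M] :
    (¬ ∃ I : Order.Ideal (Set M), IsIdealOn I ∧
      ∀ (X : Type u) [TopologicalSpace X] [T2Space X], InFinBW I X ↔ IsHindman X) ∧
    ∀ I : Order.Ideal (Set M), IsIdealOn I →
      (IsUnboring I ↔ ∃ 𝒜 : Set (Set ℕ), 𝒜.Infinite ∧ IsADFamily 𝒜 ∧
        Uncountable (MrowkaSpace 𝒜) ∧ InFinBW I (MrowkaSpace 𝒜) ∧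
          ¬ IsHindman (MrowkaSpace 𝒜)) ∧
      (IsUnboring I ↔ ∃ (X : Type u) (_ : TopologicalSpace X),
        InFinBW I X ∧ ¬ IsHindman X) := by
  have hlift : ∀ I : Order.Ideal (Set M), IsIdealOn I → IsUnboring I →
      ∃ (X : Type u) (_ : TopologicalSpace X), InFinBW I X ∧ ¬ IsHindman X := by
    intro I hI hu
    obtain ⟨𝒜, -, -, -, hF, hH⟩ := exists_mrowkaSpace_of_isUnboring hCH hI hu
    -- The Mrówka space lives in `Type`; lifting moves it to the arbitrary universe `u`.
    exact ⟨ULift.{u} (MrowkaSpace 𝒜), inferInstance, hF.of_homeomorph Homeomorph.ulift.symm,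
      fun h => hH (h.of_homeomorph Homeomorph.ulift)⟩
  refine ⟨?_, fun I hI => ⟨⟨exists_mrowkaSpace_of_isUnboring hCH hI, ?_⟩, ⟨hlift I hI, ?_⟩⟩⟩
  · rintro ⟨I, hI, h⟩
    by_cases hb : IsBoring I
    · have : Infinite unitInterval := (Set.Icc_infinite zero_lt_one).to_subtype
      have hF : InFinBW I (ULift.{u} (unitInterval × unitInterval)) :=
        (h _).2 ((IsHindman.of_compact_firstCountable _).of_homeomorph Homeomorph.ulift.symm)
      exact not_inFinBW_prod_of_isBoring hb (hF.of_homeomorph Homeomorph.ulift)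
    · obtain ⟨X, _, hF, hH⟩ := hlift I hI hb
      have := hF.1
      exact hH ((h X).1 hF)
  · rintro ⟨𝒜, -, -, -, hF, hH⟩ hb
    exact hH (.of_isBoring hI hb hF)
  · rintro ⟨X, _, hF, hH⟩ hb
    exact hH (.of_isBoring hI hb hF)
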